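/- **Setting.** Let $P_{s,t}(x,y)$ ($0\le s\le t$; $x,y\in\mathbb Z$) be a standard Markov transition function on $\mathbb Z$, not necessarily time-homogeneous (so continuous-time chains are covered, and so are discrete-time chains, viewed as constant on each interval $[n,n+1)$). Let $(X_x)_{x\in\mathbb Z}$ be independent Markov processes with transition function $P$ and right-continuous paths, with $X_x(0)=x$. Assume that the process is *skip-free*: for all $x<y$, almost surely, $X_x(t)>X_y(t)$ implies $X_x(s)=X_y(s)$ for some $s\le t$. The *coalescing system* $(Z_x)_{x\in\mathbb Z}$, with every site initially occupied, is given by Arratia's construction: fix any enumeration of $\mathbb Z$; each particle follows its own path until it first meets the trajectory of a particle that is earlier in the enumeration, and follows that particle from then on. Fix $T>0$. The distinct positions $Z_x(T)$ are the *survivors*; the *basin* of a survivor is the set of the initial sites $x$ whose particles end there; there is a *wall* at $w+\tfrac12$ ($w\in\mathbb Z$) if $Z_w(T)\ne Z_{w+1}(T)$. For $x_{1/2}<\dots<x_{k-1/2}$ in $\mathbb Z+\tfrac12$ and $y_0<\dots<y_k$ in $\mathbb Z$, $k\ge 1$, the *consecutive pattern* $y_0\nwarrow x_{1/2}\nearrow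 y_1\nwarrow\cdots\nwarrow x_{k-1/2}\nearrow y_k$ *occurs* if every $x_i$ is a wall, there is no other wall between $x_{1/2}$ and $x_{k-1/2}$, and for every $i$ the basins directly to the left and to the right of $x_i$ belong to the survivors $y_{i-1/2}$ and $y_{i+1/2}$, respectively. **Coalescence matrix.** Write $p(x,y)=P_{0,T}(x,y)$ and $F(x,y)=\sum_{z\le y}p(x,z)$. For particles started at $u_1\le\dots\le u_n$, grouped into consecutive blocks, where the particles of a block are to merge into one survivor, let $v_j$ be the position of the survivor of the block of particle $j$. The coalescence matrix is the $n\times n$ matrix with entries $\tilde M_{ij}=p(u_i,v_j)$ if $j$ is the first particle of its block, and $\tilde M_{ij}=F(u_i,v_j)-[i<j]$ otherwise. **Theorem (multi-pattern correlation function).** Consider $m$ patterns with $k_\alpha\ge1$ walls and $k_\alpha+1$ survivors, $$y^{(\alpha)}_0 \nwarrow x^{(\alpha)}_{1/2}\nearrow y^{(\alpha)}_1\nwarrow\cdots\nwarrow x^{(\alpha)}_{k_\alpha-1/2}\nearrow y^{(\alpha)}_{k_\alpha}\qquad(\alpha=1,\dots,m),$$ such that the walls, listed pattern after pattern, are strictly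 increasing, and so are the survivors. The number of survivors between consecutive patterns is unspecified. The probability that all $m$ patterns occur simultaneously equals $\det(\tilde M)$, where $\tilde M$ is the coalescence matrix of the $2K$ flanking particles ($K=\sum_\alpha k_\alpha$) started at $x-\tfrac12,\ x+\tfrac12$ for the walls $x$, listed in increasing order of the walls, with the following blocks. The $2k_\alpha$ flanking particles of pattern $\alpha$ are grouped as $1+2+\cdots+2+1$: the leftmost one survives alone at $y^{(\alpha)}_0$, the right neighbour of the $l$-th wall and the left neighbour of the $(l+1)$-st wall merge into the survivor $y^{(\alpha)}_l$ for $1\le l<k_\alpha$, and the rightmost one survives alone at $y^{(\alpha)}_{k_\alpha}$. No block contains particles of two patterns. -/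

import Mathlib

open MeasureTheory ProbabilityTheory Filter Topology
open scoped NNReal

/-- A (possibly time-inhomogeneous) standard Markov transition function on `ℤ`:
`prob s t x y` is the probability of being at `y` at time `t`, starting at `x` at time `s ≤ t`.
Discrete-time chains are included: they are constant on every interval `[n, n + 1)`, and
their transition function is `prob s t = p ⌊s⌋ ⌊t⌋`. -/
structure TransitionFunction where
  prob : ℝ≥0 → ℝ≥0 → ℤ → ℤ → ℝ
  nonneg : ∀ s t, s ≤ t → ∀ x y, 0 ≤ prob s t x y
  hasSum_one : ∀ s t, s ≤ t → ∀ x, HasSum (fun y => prob s t x y) 1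
  prob_self : ∀ s x y, prob s s x y = if x = y then 1 else 0
  chapman_kolmogorov : ∀ r s t, r ≤ s → s ≤ t → ∀ x y,
    HasSum (fun z => prob r s x z * prob s t z y) (prob r t x y)
  standard : ∀ s x, Tendsto (fun t => prob s t x x) (𝓝[>] s) (𝓝 1)

/-- `X x`, for `x : ℤ`, are independent Markov processes with right-continuous paths and with the
common transition function `P`; the process `X x` starts at the site `x` at time `0`. -/
structure IsIndepMarkovFamily {Ω : Type*} [MeasurableSpace Ω] (P : TransitionFunction)
    (X : ℤ → ℝ≥0 → Ω → ℤ) (μ : Measure Ω) : Prop where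
  measurable : ∀ x t, Measurable (X x t)
  start : ∀ x ω, X x 0 ω = x
  rightContinuous : ∀ x ω t, ContinuousWithinAt (fun s => X x s ω) (Set.Ici t) t
  /-- Markov property: `A` ranges over the events determined by the path up to time `s`. -/
  markov : ∀ (x : ℤ) (s t : ℝ≥0), s ≤ t → ∀ (z z' : ℤ) (A : Set Ω),
    MeasurableSet[⨆ r : Set.Iic s, MeasurableSpace.comap (X x r) ⊤] A →
    μ.real (A ∩ {ω | X x s ω = z ∧ X x t ω = z'}) =
      μ.real (A ∩ {ω | X x s ω = z}) * P.prob s t z z'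
  indep : iIndepFun (fun x ω t => X x t ω) μ

/-- Skip-freeness: almost surely, two independent particles started at different sites do not
exchange their order without having shared a site before. -/
def SkipFree {Ω : Type*} [MeasurableSpace Ω] (X : ℤ → ℝ≥0 → Ω → ℤ) (μ : Measure Ω) : Prop :=
  ∀ x y : ℤ, x < y →
    ∀ᵐ ω ∂μ, ∀ t, X y t ω < X x t ω → ∃ s ≤ t, X x s ω = X y s ω

open Classical in
/-- Arratia's construction. Particles are ranked by `ℕ`. Particle `k` follows its own path `X k`
up to the first time `τ` at which it meets (the coalesced trajectory of) some particle `j` of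
smaller rank; from then on it follows that particle. If several such particles are met at the time `τ`,
then they have already merged with each other, and the choice of `j` is immaterial. (If no such
meeting ever takes place, then the set of meeting times is empty and the condition `∃ j, …` fails.) -/
noncomputable def rankedCoalescence (X : ℕ → ℝ≥0 → ℤ) (k : ℕ) (t : ℝ≥0) : ℤ :=
  let τ : ℝ≥0 := sInf {s | ∃ j : Fin k, rankedCoalescence X j s = X k s}
  if h : τ ≤ t ∧ ∃ j : Fin k, rankedCoalescence X j τ = X k τ then
    rankedCoalescence X h.2.choose t
  else X k t
termination_by k

/-- The coalescing system with every site of `ℤ` initially occupied: the position at time `t` of the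
particle started at the site `x`, when `X x` are the driving paths and `e` is an enumeration
of the sites, giving their ranks. -/
noncomputable def coalescing (e : ℕ ≃ ℤ) (X : ℤ → ℝ≥0 → ℤ) (x : ℤ) (t : ℝ≥0) : ℤ :=
  rankedCoalescence (fun n => X (e n)) (e.symm x) t

/-- Let `z x` be the final position of the particle started at `x`. The half-integer `w + 1/2` is a
wall if `w` and `w + 1` lie in different basins. -/
def IsWall (z : ℤ → ℤ) (w : ℤ) : Prop := z w ≠ z (w + 1)

/-- The consecutive pattern `y 0 ↖ x 0 ↗ y 1 ↖ x 1 ↗ ⋯ ↖ x (k-1) ↗ y k` occurs: the `x l + 1/2` are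
walls, no other wall lies between the first and the last of them, and the survivors owning the basins
directly to the left and to the right of the wall `x l + 1/2` are at `y l` and `y (l + 1)`. -/
def ContainsPattern (z : ℤ → ℤ) {k : ℕ} (x : Fin k → ℤ) (y : Fin (k + 1) → ℤ) : Prop :=
  (∀ l, IsWall z (x l)) ∧
  (∀ w, IsWall z w → (∃ l, x l ≤ w) → (∃ l, w ≤ x l) → ∃ l, x l = w) ∧
  (∀ l : Fin k, z (x l) = y l.castSucc ∧ z (x l + 1) = y l.succ)

/-- Positions in several consecutive finite groups are globally strictly increasing. -/
def GloballyIncreasing {m : ℕ} {n : Fin m → ℕ} (x : (α : Fin m) → Fin (n α) → ℤ) : Prop :=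
  (∀ α, StrictMono (x α)) ∧ ∀ α β, α < β → ∀ i j, x α i < x β j

/-- Cumulative sums `F(x, y) = ∑_{z ≤ y} p(x, z)`. -/
noncomputable def cumulative (p : ℤ → ℤ → ℝ) (x y : ℤ) : ℝ := ∑' z : Set.Iic y, p x z

open Classical in
/-- The coalescence matrix for particles, indexed by the linear order `ι` and started at `x i`, with
one-particle transition probabilities `p`. The coalescence pattern is given by `block`: the particles
with the same value of `block` merge, and the survivor of the block `b` is at `y b`. The first particle
of each block gives a `p` column; every other particle `j` of the block gives a column of
entries `F - [i < j]`. -/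
noncomputable def coalescenceMatrix {ι B : Type*} [LinearOrder ι] (p : ℤ → ℤ → ℝ)
    (x : ι → ℤ) (block : ι → B) (y : B → ℤ) : Matrix ι ι ℝ :=
  Matrix.of fun i j =>
    if ∃ j' < j, block j' = block j then
      cumulative p (x i) (y (block j)) - (if i < j then 1 else 0)
    else p (x i) (y (block j))

/-- Indices of the `2K` flanking particles, in increasing (lexicographic) order: in the `α`-th pattern,
`2l` is the left neighbour and `2l + 1` the right neighbour of the `l`-th wall. -/
abbrev Flanking {m : ℕ} (k : Fin m → ℕ) : Type := Σₗ α : Fin m, Fin (2 * k α)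

/-- Starting position of a flanking particle: `a = x l` or `b = x l + 1`, where the wall is
at `x l + 1/2`. -/
def flankingPosition {m : ℕ} {k : Fin m → ℕ} (x : (α : Fin m) → Fin (k α) → ℤ)
    (q : Flanking k) : ℤ :=
  x (ofLex q).1 ⟨(ofLex q).2 / 2, by have := (ofLex q).2.isLt; omega⟩ + ((ofLex q).2 % 2 : ℕ)

/-- The coalescence pattern `1 + 2 + ⋯ + 2 + 1` within each of the patterns: the particles
`0 | 1, 2 | 3, 4 | ⋯ | 2k - 1` of the pattern `α` end in its survivors `0, 1, 2, …, k`. -/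
def flankingBlock {m : ℕ} {k : Fin m → ℕ} (q : Flanking k) : Σ α : Fin m, Fin (k α + 1) :=
  ⟨(ofLex q).1, ⟨((ofLex q).2 + 1) / 2, by have := (ofLex q).2.isLt; omega⟩⟩

/-- The matrix `M̃` of the `2K` flanking particles of `m` patterns. -/
noncomputable def multiPatternMatrix (p : ℤ → ℤ → ℝ) {m : ℕ} {k : Fin m → ℕ}
    (x : (α : Fin m) → Fin (k α) → ℤ) (y : (α : Fin m) → Fin (k α + 1) → ℤ) :
    Matrix (Flanking k) (Flanking k) ℝ :=
  coalescenceMatrix p (flankingPosition x) flankingBlock (fun b => y b.1 b.2)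

/-! ### Linear algebra of the coalescence matrix -/

section Determinant

variable {ι B : Type*} [LinearOrder ι]

/-! Evaluate the determinant of the coalescence matrix for `P.prob t T` at the time-`t` positions of
the coalescing flanking particles. Its mean does not depend on `t`. Each entry is a space-time
harmonic function of the position of its row, and products of such functions along independent paths
are harmonic again, so the Leibniz expansion works as long as all rows follow different paths.
Merged particles share a path, but their rows differ only by the constants `[i < j]`; subtracting
one of these rows from the others leaves a single nonconstant row per path (`det_reducedMatrix`,
`setIntegral_det`). A meeting changes which path is followed but no position, hence not the
determinant.

At `t = 0` the mean is the claimed determinant. At `t = T` the matrix has entries in `{-1, 0, 1}`,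
and for ordered positions its determinant is the indicator of the prescribed endpoints
(`det_coalescenceMatrix_identity`). Skip-freeness serves only to order the final positions
(`rankedCoalescence_le_of_skipFree`).

Stopping times are avoided by noticing meetings only on a time grid. The mean is conserved exactly
on every grid; pathwise, a fine grid misses no meeting (`exists_pos_gridLeader_eq`), and dominated
convergence concludes. Finally, monotonicity reduces the patterns to the endpoints of the flanking
particles (`containsPattern_iff`). -/

theorem coalescenceMatrix_apply_of_first (p : ℤ → ℤ → ℝ) (x : ι → ℤ) (block : ι → B) (y : B → ℤ)
    {i j : ι} (hj : ¬ ∃ j' < j, block j' = block j) :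
    coalescenceMatrix p x block y i j = p (x i) (y (block j)) := by
  simp only [coalescenceMatrix, Matrix.of_apply, if_neg hj]

theorem coalescenceMatrix_apply_of_not_first (p : ℤ → ℤ → ℝ) (x : ι → ℤ) (block : ι → B)
    (y : B → ℤ) {i j : ι} (hj : ∃ j' < j, block j' = block j) :
    coalescenceMatrix p x block y i j =
      cumulative p (x i) (y (block j)) - (if i < j then 1 else 0) := by
  simp only [coalescenceMatrix, Matrix.of_apply, if_pos hj]

theorem cumulative_identity {p : ℤ → ℤ → ℝ} (hp : ∀ x y, p x y = if x = y then 1 else 0)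
    (x y : ℤ) : cumulative p x y = if x ≤ y then 1 else 0 := by
  unfold cumulative
  rw [tsum_subtype (Set.Iic y) (fun z => p x z), tsum_eq_single x]
  · by_cases h : x ≤ y <;> simp [Set.indicator, h, hp]
  · intro z hz
    simp [Set.indicator, hp, Ne.symm hz]

variable [Fintype ι]

/-- When all positions match, the matrix is lower unitriangular. Otherwise take the first mismatch
`i`: agreement before `i` and monotonicity force column `i` to vanish, row `i` to vanish, or row `i`
to repeat the preceding row. -/
theorem det_coalescenceMatrix_identity {p : ℤ → ℤ → ℝ}
    (hp : ∀ x y, p x y = if x = y then 1 else 0) {z : ι → ℤ} (hz : Monotone z) {block : ι → B}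
    {y : B → ℤ} (hv : Monotone fun i => y (block i))
    (hb : ∀ i j, y (block i) = y (block j) → block i = block j) [Decidable (∀ i, z i = y (block i))] :
    (coalescenceMatrix p z block y).det = if ∀ i, z i = y (block i) then 1 else 0 := by
  have first {i j : ι} (hj : ¬ ∃ j' < j, block j' = block j) :
      coalescenceMatrix p z block y i j = if z i = y (block j) then 1 else 0 := by
    rw [coalescenceMatrix_apply_of_first _ _ _ _ hj, hp]
  have later {i j : ι} (hj : ∃ j' < j, block j' = block j) :
      coalescenceMatrix p z block y i j =
        (if z i ≤ y (block j) then 1 else 0) - (if i < j then 1 else 0) := by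
    rw [coalescenceMatrix_apply_of_not_first _ _ _ _ hj, cumulative_identity hp]
  split_ifs with h
  · rw [Matrix.det_of_isLowerTriangular, Finset.prod_eq_one]
    · intro i _
      by_cases hi : ∃ j' < i, block j' = block i
      · rw [later hi]; simp [h]
      · rw [first hi]; simp [h]
    · intro i j hij
      have hij : i < j := by simpa using hij
      by_cases hj : ∃ j' < j, block j' = block j
      · rw [later hj, if_pos ((h i).le.trans (hv hij.le)), if_pos hij, sub_self]
      · rw [first hj, if_neg]
        intro he
        exact hj ⟨i, hij, hb _ _ ((h i).symm.trans he)⟩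
  · obtain ⟨i, hi, hmin⟩ : ∃ i, z i ≠ y (block i) ∧ ∀ l < i, z l = y (block l) := by
      push Not at h
      obtain ⟨i, hi, hm⟩ := WellFounded.has_min (wellFounded_lt (α := ι))
        {i | z i ≠ y (block i)} h
      exact ⟨i, hi, fun l hl => by_contra fun hne => hm l hne hl⟩
    by_cases hf : ∃ j' < i, block j' = block i
    · obtain ⟨j', hj', hbj⟩ := hf
      have hgt : y (block i) < z i := by
        refine lt_of_le_of_ne ?_ (Ne.symm hi)
        rw [← hbj, ← hmin j' hj']
        exact hz hj'.le
      refine Matrix.det_eq_zero_of_column_eq_zero i fun l => ?_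
      rw [later ⟨j', hj', hbj⟩]
      rcases lt_or_ge l i with hl | hl
      · rw [if_pos ((hmin l hl).le.trans (hv hl.le)), if_pos hl, sub_self]
      · rw [if_neg (not_le.2 (hgt.trans_le (hz hl))), if_neg (not_lt.2 hl), sub_self]
    · rcases lt_or_gt_of_ne hi with hlt | hgt
      · by_cases hl : ∃ l < i, y (block l) = z i
        · obtain ⟨l, ⟨hli, hlz⟩, hmax⟩ := WellFounded.has_min (wellFounded_gt (α := ι))
            {l | l < i ∧ y (block l) = z i} hl
          -- As `l` and `i` are adjacent, `[l < j]` and `[i < j]` differ only for `j = i`, and that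
          -- column, being first in its block, has no such term.
          have hgap : ∀ j, l < j → ¬ j < i := by
            intro j hlj hji
            refine hmax j ⟨hji, ?_⟩ hlj
            refine le_antisymm ?_ ?_
            · rw [← hmin j hji]; exact hz hji.le
            · rw [← hlz]; exact hv hlj.le
          refine Matrix.det_zero_of_row_eq hli.ne ?_
          funext j
          by_cases hj : ∃ j' < j, block j' = block j
          · have hji : j ≠ i := fun he => hf (he ▸ hj)
            have : l < j ↔ i < j :=
              ⟨fun h1 => lt_of_le_of_ne (not_lt.1 (hgap j h1)) (Ne.symm hji), fun h1 => hli.trans h1⟩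
            rw [later hj, later hj, hmin l hli, hlz]
            simp only [this]
          · rw [first hj, first hj, hmin l hli, hlz]
        · refine Matrix.det_eq_zero_of_row_eq_zero i fun j => ?_
          by_cases hj : ∃ j' < j, block j' = block j
          · rw [later hj]
            rcases lt_trichotomy j i with hji | rfl | hij
            · rw [if_neg, if_neg hji.not_gt, sub_self]
              intro hle
              exact hl ⟨j, hji, le_antisymm (hmin j hji ▸ hz hji.le) hle⟩
            · exact absurd hj hf
            · rw [if_pos (hlt.le.trans (hv hij.le)), if_pos hij, sub_self]
          · rw [first hj, if_neg]
            intro he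
            rcases lt_or_ge j i with hji | hij
            · exact hl ⟨j, hji, he.symm⟩
            · exact absurd he (hlt.trans_le (hv hij)).ne
      · refine Matrix.det_eq_zero_of_column_eq_zero i fun l => ?_
        rw [first hf, if_neg]
        rcases lt_or_ge l i with hl | hl
        · rw [hmin l hl]
          exact fun he => hf ⟨l, hl, hb _ _ he⟩
        · exact (hgt.trans_le (hz hl)).ne'

/-- The last index with the same leader as `i`. -/
noncomputable def classMax {K : Type*} (κ : ι → K) (i : ι) : ι := by
  classical
  exact (Finset.univ.filter fun l => κ l = κ i).max' ⟨i, by simp⟩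

theorem apply_classMax {K : Type*} (κ : ι → K) (i : ι) : κ (classMax κ i) = κ i := by
  classical
  have : classMax κ i ∈ Finset.univ.filter fun l => κ l = κ i := Finset.max'_mem _ _
  simpa using this

theorem le_classMax {K : Type*} {κ : ι → K} {i l : ι} (h : κ l = κ i) : l ≤ classMax κ i := by
  classical
  exact Finset.le_max' (Finset.univ.filter fun l => κ l = κ i) l (by simpa using h)

theorem classMax_congr {K : Type*} {κ : ι → K} {i l : ι} (h : κ l = κ i) :
    classMax κ l = classMax κ i :=
  le_antisymm (le_classMax ((apply_classMax κ l).trans h))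
    (le_classMax ((apply_classMax κ i).trans h.symm))

open Classical in
/-- The coalescence matrix of particles of which `i` is at `z (κ i)`, after subtraction of the row of
the last particle with the same value of `κ` from all the other ones: those rows become constant. -/
noncomputable def reducedMatrix {K : Type*} (p : ℤ → ℤ → ℝ) (κ : ι → K) (z : K → ℤ) (block : ι → B)
    (y : B → ℤ) : Matrix ι ι ℝ :=
  Matrix.of fun i j =>
    if classMax κ i = i then coalescenceMatrix p (z ∘ κ) block y i j
    else if ∃ j' < j, block j' = block j then
      (if classMax κ i < j then 1 else 0) - (if i < j then 1 else 0)
    else 0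

/-- The row operations form an upper unitriangular matrix `U`, because the subtracted row is the
last of its class. -/
theorem det_reducedMatrix {K : Type*} (p : ℤ → ℤ → ℝ) (κ : ι → K) (z : K → ℤ) (block : ι → B)
    (y : B → ℤ) :
    (reducedMatrix p κ z block y).det = (coalescenceMatrix p (z ∘ κ) block y).det := by
  classical
  set M := coalescenceMatrix p (z ∘ κ) block y with hM
  let U : Matrix ι ι ℝ := Matrix.of fun i j =>
    (if j = i then 1 else 0) - (if j = classMax κ i then if classMax κ i = i then 0 else 1 else 0)
  have hU : U.det = 1 := by
    rw [Matrix.det_of_isUpperTriangular, Finset.prod_eq_one]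
    · intro i _
      simp only [U, Matrix.of_apply]
      by_cases h : classMax κ i = i
      · simp [h]
      · simp [Ne.symm (show classMax κ i ≠ i from h)]
    · intro i j hji
      have hji : j < i := by simpa using hji
      have h1 : j ≠ classMax κ i := (hji.trans_le (le_classMax rfl)).ne
      simp [U, hji.ne, h1]
  have hmul : reducedMatrix p κ z block y = U * M := by
    ext i j
    have hsum : (U * M) i j = M i j - (if classMax κ i = i then 0 else 1) * M (classMax κ i) j := by
      simp only [Matrix.mul_apply, U, Matrix.of_apply, sub_mul, Finset.sum_sub_distrib, ite_mul,
        one_mul, zero_mul, Finset.sum_ite_eq', Finset.mem_univ, if_true]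
    rw [hsum]
    simp only [reducedMatrix, Matrix.of_apply]
    by_cases h : classMax κ i = i
    · simp [h, hM]
    · simp only [if_neg h, one_mul]
      by_cases hj : ∃ j' < j, block j' = block j
      · rw [if_pos hj, hM, coalescenceMatrix_apply_of_not_first _ _ _ _ hj,
          coalescenceMatrix_apply_of_not_first _ _ _ _ hj]
        simp only [Function.comp, apply_classMax]
        ring_nf
      · rw [if_neg hj, hM, coalescenceMatrix_apply_of_first _ _ _ _ hj,
          coalescenceMatrix_apply_of_first _ _ _ _ hj]
        simp only [Function.comp, apply_classMax, sub_self]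
  rw [hmul, Matrix.det_mul, hU, one_mul]

end Determinant

/-! ### Pathwise analysis of Arratia's construction -/

section Paths

variable {x : ℕ → ℝ≥0 → ℤ}

/-- Otherwise some `[sInf S, b)` would miss `S`. For right-continuous integer-valued paths this
makes first meeting and first crossing times attained. -/
theorem csInf_mem_of_eventually_nhdsGE {S : Set ℝ≥0} (hS : S.Nonempty)
    (h : ∀ t, t ∉ S → ∀ᶠ s in 𝓝[≥] t, s ∉ S) : sInf S ∈ S := by
  by_contra hn
  obtain ⟨b, hb, hbS⟩ := (mem_nhdsGE_iff_exists_Ico_subset' (lt_add_one (sInf S))).1 (h _ hn)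
  obtain ⟨s, hs, hsb⟩ := exists_lt_of_csInf_lt hS (show sInf S < b from hb)
  exact hbS ⟨csInf_le (OrderBot.bddBelow S) hs, hsb⟩ hs

/-- The alternative in Arratia's construction: a particle either meets no trajectory of smaller rank
at all, or there is a first meeting. -/
theorem rankedCoalescence_spec (hx : ∀ k t, ∀ᶠ s in 𝓝[≥] t, x k s = x k t) (k : ℕ) :
    (∀ t, ∀ᶠ s in 𝓝[≥] t, rankedCoalescence x k s = rankedCoalescence x k t) ∧
    (((∀ s, ∀ j < k, rankedCoalescence x j s ≠ x k s) ∧ ∀ t, rankedCoalescence x k t = x k t) ∨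
      ∃ τ, ∃ j < k, (∀ s < τ, ∀ i < k, rankedCoalescence x i s ≠ x k s) ∧
        rankedCoalescence x j τ = x k τ ∧ (∀ t < τ, rankedCoalescence x k t = x k t) ∧
        ∀ t, τ ≤ t → rankedCoalescence x k t = rankedCoalescence x j t) := by
  induction k using Nat.strong_induction_on with
  | _ k ih =>
    have hunf : ∀ t, rankedCoalescence x k t =
        if h : sInf {s | ∃ j : Fin k, rankedCoalescence x j s = x k s} ≤ t ∧
          ∃ j : Fin k, rankedCoalescence x j
            (sInf {s | ∃ j : Fin k, rankedCoalescence x j s = x k s}) =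
            x k (sInf {s | ∃ j : Fin k, rankedCoalescence x j s = x k s})
        then rankedCoalescence x h.2.choose t else x k t := by
      intro t
      rw [rankedCoalescence]
    set S := {s | ∃ j : Fin k, rankedCoalescence x j s = x k s} with hS
    by_cases hne : S.Nonempty
    · have hmem : sInf S ∈ S := by
        refine csInf_mem_of_eventually_nhdsGE hne fun t ht => ?_
        -- Right-continuity of the trajectories of smaller rank is needed here, so it is carried
        -- through the same induction.
        have h1 : ∀ᶠ s in 𝓝[≥] t, ∀ j : Fin k,
            rankedCoalescence x j s = rankedCoalescence x j t :=
          eventually_all.2 fun j => (ih j j.2).1 t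
        filter_upwards [h1, hx k t] with s hs1 hs2
        rintro ⟨j, hj⟩
        exact ht ⟨j, by rw [← hs1, ← hs2, hj]⟩
      have hlow : ∀ s < sInf S, ∀ i < k, rankedCoalescence x i s ≠ x k s := fun s hs i hi he =>
        notMem_of_lt_csInf hs (OrderBot.bddBelow S) ⟨⟨i, hi⟩, he⟩
      have hbefore : ∀ t < sInf S, rankedCoalescence x k t = x k t := fun t ht => by
        rw [hunf, dif_neg fun h => ht.not_ge h.1]
      have hmem' : ∃ j : Fin k, rankedCoalescence x j (sInf S) = x k (sInf S) := hmem
      have hafter : ∀ t, sInf S ≤ t →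
          rankedCoalescence x k t = rankedCoalescence x hmem'.choose t := fun t ht => by
        rw [hunf, dif_pos ⟨ht, hmem'⟩]
      refine ⟨fun t => ?_, Or.inr ⟨sInf S, hmem'.choose, hmem'.choose.2, hlow, hmem'.choose_spec,
        hbefore, hafter⟩⟩
      rcases lt_or_ge t (sInf S) with ht | ht
      · have h2 : ∀ᶠ s in 𝓝[≥] t, s < sInf S := nhdsWithin_le_nhds (eventually_lt_nhds ht)
        filter_upwards [hx k t, h2] with s hs1 hs2
        rw [hbefore s hs2, hbefore t ht, hs1]
      · filter_upwards [(ih _ hmem'.choose.2).1 t, self_mem_nhdsWithin] with s hs1 hs2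
        rw [hafter s (ht.trans hs2), hafter t ht, hs1]
    · have hnever : ∀ s, ∀ j < k, rankedCoalescence x j s ≠ x k s := fun s j hj he =>
        hne ⟨s, ⟨j, hj⟩, he⟩
      have heq : ∀ t, rankedCoalescence x k t = x k t := fun t => by
        rw [hunf, dif_neg]
        rintro ⟨-, j, hj⟩
        exact hnever _ j j.2 hj
      refine ⟨fun t => ?_, Or.inl ⟨hnever, heq⟩⟩
      simpa only [heq] using hx k t

variable (hx : ∀ k t, ∀ᶠ s in 𝓝[≥] t, x k s = x k t)
include hx

theorem rankedCoalescence_eventually_eq (k : ℕ) (t : ℝ≥0) :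
    ∀ᶠ s in 𝓝[≥] t, rankedCoalescence x k s = rankedCoalescence x k t :=
  (rankedCoalescence_spec hx k).1 t

theorem exists_lt_of_rankedCoalescence_ne {k : ℕ} {t : ℝ≥0} (h : rankedCoalescence x k t ≠ x k t) :
    ∃ τ < t, ∃ j < k, rankedCoalescence x j τ = x k τ ∧
      ∀ s, τ ≤ s → rankedCoalescence x k s = rankedCoalescence x j s := by
  rcases (rankedCoalescence_spec hx k).2 with ⟨-, h2⟩ | ⟨τ, j, hj, -, h2, h3, h4⟩
  · exact absurd (h2 t) h
  · refine ⟨τ, ?_, j, hj, h2, h4⟩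
    by_contra hle
    rcases (not_lt.1 hle).lt_or_eq with hlt | rfl
    · exact h (h3 t hlt)
    · exact h ((h4 t le_rfl).trans h2)

/-- A particle which has met no particle of smaller rank before time `t` has followed its own path
up to the time `t`, inclusive. -/
theorem rankedCoalescence_eq_self {k : ℕ} {t : ℝ≥0}
    (h : ∀ s < t, ∀ j < k, rankedCoalescence x j s ≠ rankedCoalescence x k s) :
    rankedCoalescence x k t = x k t := by
  by_contra hne
  obtain ⟨τ, hτ, j, hj, -, h4⟩ := exists_lt_of_rankedCoalescence_ne hx hne
  exact h τ hτ j hj (h4 τ le_rfl).symm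

theorem rankedCoalescence_zero (k : ℕ) : rankedCoalescence x k 0 = x k 0 :=
  rankedCoalescence_eq_self hx fun _ hs => absurd hs not_lt_zero

/-- Once together, particles stay together. -/
theorem rankedCoalescence_merged {a b : ℕ} {s t : ℝ≥0}
    (h : rankedCoalescence x a s = rankedCoalescence x b s) (hst : s ≤ t) :
    rankedCoalescence x a t = rankedCoalescence x b t := by
  induction b using Nat.strong_induction_on generalizing a with
  | _ b ihb =>
    induction a using Nat.strong_induction_on with
    | _ a iha =>
      -- Of two particles together at time `s`, the one of larger rank already follows some `j` of
      -- smaller rank and can be replaced by it.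
      have key : ∀ {a b : ℕ}, a < b → rankedCoalescence x a s = rankedCoalescence x b s →
          ∃ j < b, rankedCoalescence x b s = rankedCoalescence x j s ∧
            rankedCoalescence x b t = rankedCoalescence x j t := by
        intro a b hab h
        rcases (rankedCoalescence_spec hx b).2 with ⟨h1, h2⟩ | ⟨τ, j, hj, h1, -, h3, h4⟩
        · exact absurd (h.trans (h2 s)) (h1 s a hab)
        · have hτ : τ ≤ s := by
            by_contra hlt
            exact h1 s (not_le.1 hlt) a hab (h.trans (h3 s (not_le.1 hlt)))
          exact ⟨j, hj, h4 s hτ, h4 t (hτ.trans hst)⟩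
      rcases lt_trichotomy a b with hab | rfl | hab
      · obtain ⟨j, hj, h1, h2⟩ := key hab h
        rw [h2]
        exact ihb j hj (h.trans h1)
      · rfl
      · obtain ⟨j, hj, h1, h2⟩ := key hab h.symm
        rw [h2]
        exact iha j hj (h1.symm.trans h)

omit hx

/-- The particle of smallest rank at the position of the particle `k` at time `t`. -/
noncomputable def leader (x : ℕ → ℝ≥0 → ℤ) (t : ℝ≥0) (k : ℕ) : ℕ :=
  sInf {j | rankedCoalescence x j t = rankedCoalescence x k t}

theorem rankedCoalescence_leader (x : ℕ → ℝ≥0 → ℤ) (t : ℝ≥0) (k : ℕ) :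
    rankedCoalescence x (leader x t k) t = rankedCoalescence x k t :=
  Nat.sInf_mem (s := {j | rankedCoalescence x j t = rankedCoalescence x k t}) ⟨k, rfl⟩

theorem leader_le {t : ℝ≥0} {j k : ℕ} (h : rankedCoalescence x j t = rankedCoalescence x k t) :
    leader x t k ≤ j :=
  Nat.sInf_le h

theorem rankedCoalescence_ne_of_lt_leader {t : ℝ≥0} {j k : ℕ} (h : j < leader x t k) :
    rankedCoalescence x j t ≠ rankedCoalescence x (leader x t k) t := fun he =>
  h.not_ge (leader_le (he.trans (rankedCoalescence_leader x t k)))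

include hx

theorem leader_antitone (k : ℕ) : Antitone fun t => leader x t k := fun s _ hst =>
  leader_le (rankedCoalescence_merged hx (rankedCoalescence_leader x s k) hst)

theorem rankedCoalescence_ne_of_lt_leader_of_le {s t : ℝ≥0} {j k : ℕ} (h : j < leader x t k)
    (hst : s ≤ t) :
    rankedCoalescence x j s ≠ rankedCoalescence x (leader x t k) s := fun he =>
  rankedCoalescence_ne_of_lt_leader h (rankedCoalescence_merged hx he hst)

theorem rankedCoalescence_leader_eq_self {s t : ℝ≥0} (k : ℕ) (hst : s ≤ t) :
    rankedCoalescence x (leader x t k) s = x (leader x t k) s :=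
  rankedCoalescence_eq_self hx fun _ hr _ hj =>
    rankedCoalescence_ne_of_lt_leader_of_le hx hj (hr.le.trans hst)

/-- Shortly before `t`, and at `t`, two coalescing trajectories follow two fixed driving paths which have
not yet merged with paths of smaller rank before `t`. -/
theorem exists_eq_self_before {t : ℝ≥0} (ht : 0 < t) (a b : ℕ) :
    ∃ α β, ∃ s₀ < t, rankedCoalescence x α s₀ = rankedCoalescence x a s₀ ∧
      rankedCoalescence x β s₀ = rankedCoalescence x b s₀ ∧
      ∀ s ≤ t, rankedCoalescence x α s = x α s ∧ rankedCoalescence x β s = x β s := by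
  -- Ranks of leaders never increase in time, so minimality of their sum freezes both leaders on
  -- `[s₀, t)`.
  obtain ⟨s₀, hs₀, hmin⟩ := (measure fun s => leader x s a + leader x s b).wf.has_min (Set.Iio t)
    ⟨0, ht⟩
  have hconst : ∀ s, s₀ ≤ s → s < t → leader x s a = leader x s₀ a ∧
      leader x s b = leader x s₀ b := by
    intro s h1 h2
    have h3 := leader_antitone hx a h1
    have h4 := leader_antitone hx b h1
    have h5 : ¬ leader x s a + leader x s b < leader x s₀ a + leader x s₀ b := hmin s h2
    simp only at h3 h4
    omega
  refine ⟨leader x s₀ a, leader x s₀ b, s₀, hs₀, rankedCoalescence_leader _ _ _,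
    rankedCoalescence_leader _ _ _, fun s hs => ⟨?_, ?_⟩⟩
  · refine rankedCoalescence_eq_self hx fun r hr j hj => ?_
    have hr' : max s₀ r < t := max_lt hs₀ (hr.trans_le hs)
    rw [← (hconst _ (le_max_left s₀ r) hr').1] at hj ⊢
    exact rankedCoalescence_ne_of_lt_leader_of_le hx hj (le_max_right _ _)
  · refine rankedCoalescence_eq_self hx fun r hr j hj => ?_
    have hr' : max s₀ r < t := max_lt hs₀ (hr.trans_le hs)
    rw [← (hconst _ (le_max_left s₀ r) hr').2] at hj ⊢
    exact rankedCoalescence_ne_of_lt_leader_of_le hx hj (le_max_right _ _)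

/-- If the driving paths do not jump over each other, then the coalescing trajectories keep
their initial order. -/
theorem rankedCoalescence_le_of_skipFree
    (hskip : ∀ i j, x i 0 < x j 0 → ∀ t, x j t < x i t → ∃ s ≤ t, x i s = x j s)
    {a b : ℕ} (hab : x a 0 ≤ x b 0) (t : ℝ≥0) :
    rankedCoalescence x a t ≤ rankedCoalescence x b t := by
  by_contra hlt
  set S := {t | rankedCoalescence x b t < rankedCoalescence x a t} with hS
  have hmem : sInf S ∈ S := by
    refine csInf_mem_of_eventually_nhdsGE ⟨t, not_le.1 hlt⟩ fun r hr => ?_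
    filter_upwards [rankedCoalescence_eventually_eq hx a r,
      rankedCoalescence_eventually_eq hx b r] with s h1 h2
    rwa [hS, Set.mem_ofPred_eq, h1, h2]
  have hbefore : ∀ s < sInf S, rankedCoalescence x a s ≤ rankedCoalescence x b s := fun s hs =>
    not_lt.1 fun h => notMem_of_lt_csInf hs (OrderBot.bddBelow S) h
  set t' := sInf S with ht'
  have hmem : rankedCoalescence x b t' < rankedCoalescence x a t' := hmem
  have hpos : 0 < t' := by
    by_contra h0
    have h0 : t' = 0 := le_antisymm (not_lt.1 h0) zero_le
    rw [h0, rankedCoalescence_zero hx, rankedCoalescence_zero hx] at hmem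
    exact hmem.not_ge hab
  obtain ⟨α, β, s₀, hs₀, hα, hβ, hself⟩ := exists_eq_self_before hx hpos a b
  have hα' := rankedCoalescence_merged hx hα hs₀.le
  have hβ' := rankedCoalescence_merged hx hβ hs₀.le
  -- If these driving paths met, the trajectories would have merged and could not be out of order at
  -- `t'`.
  have hne : ∀ s ≤ t', x α s ≠ x β s := by
    intro s hs he
    rw [← (hself s hs).1, ← (hself s hs).2] at he
    have := rankedCoalescence_merged hx he hs
    rw [hα', hβ'] at this
    exact hmem.ne' this
  rw [← hα', ← hβ', (hself t' le_rfl).1, (hself t' le_rfl).2] at hmem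
  have hle := hbefore s₀ hs₀
  rw [← hα, ← hβ, (hself s₀ hs₀.le).1, (hself s₀ hs₀.le).2] at hle
  -- Whichever path starts on the left, it is on the right at `t'` or at `s₀`, without a meeting.
  rcases lt_trichotomy (x α 0) (x β 0) with h0 | h0 | h0
  · obtain ⟨s, hs, he⟩ := hskip α β h0 t' hmem
    exact hne s hs he
  · exact hne 0 zero_le h0
  · obtain ⟨s, hs, he⟩ := hskip β α h0 s₀ (lt_of_le_of_ne hle (hne s₀ hs₀.le))
    exact hne s (hs.trans hs₀.le) he.symm

/-- The path `k` and the trajectory it first meets, at `τ`, both stay put on some `[τ, b)`; take `ε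
= b - τ`. A time step shorter than `ε` starting before `τ` ends before `b`, so a meeting during the
step is still visible at its end. -/
theorem exists_pos_eq_self (k : ℕ) : ∃ ε > 0, ∀ s t, t < s + ε →
    (∀ j < k, rankedCoalescence x j s ≠ rankedCoalescence x k s) →
      rankedCoalescence x k t = x k t := by
  rcases (rankedCoalescence_spec hx k).2 with ⟨-, h2⟩ | ⟨τ, j, hj, -, h2, h3, h4⟩
  · exact ⟨1, one_pos, fun _ t _ _ => h2 t⟩
  · obtain ⟨b, hb, hsub⟩ := (mem_nhdsGE_iff_exists_Ico_subset' (lt_add_one τ)).1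
      ((hx k τ).and (rankedCoalescence_eventually_eq hx k τ))
    have hb : τ < b := hb
    refine ⟨b - τ, tsub_pos_of_lt hb, fun s t hts hs => ?_⟩
    have hsτ : s < τ := by
      by_contra hle
      exact hs j hj (h4 s (not_lt.1 hle)).symm
    rcases lt_or_ge t τ with ht | ht
    · exact h3 t ht
    · have htb : t < b := by
        calc t < s + (b - τ) := hts
          _ ≤ τ + (b - τ) := by gcongr
          _ = b := add_tsub_cancel_of_le hb.le
      obtain ⟨h5, h6⟩ := hsub ⟨ht, htb⟩
      rw [h6, h5, h4 τ le_rfl, h2]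

/-! ### Meetings noticed on a time grid -/

omit hx

/-- Leaders when meetings are noticed at the times `0, 1, 2, …` only: `a r k` is the
position of the path `k` at time `r`. -/
noncomputable def gridLeader (a : ℕ → ℕ → ℤ) : ℕ → ℕ → ℕ
  | 0, k => k
  | r + 1, k => gridLeader a r
      (sInf {j | a (r + 1) (gridLeader a r j) = a (r + 1) (gridLeader a r k)})

theorem gridLeader_succ_position (a : ℕ → ℕ → ℤ) (r k : ℕ) :
    a (r + 1) (gridLeader a (r + 1) k) = a (r + 1) (gridLeader a r k) :=
  Nat.sInf_mem (s := {j | a (r + 1) (gridLeader a r j) = a (r + 1) (gridLeader a r k)}) ⟨k, rfl⟩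

theorem gridLeader_le (a : ℕ → ℕ → ℤ) (r k : ℕ) : gridLeader a r k ≤ k := by
  induction r generalizing k with
  | zero => exact le_rfl
  | succ r ih => exact (ih _).trans (Nat.sInf_le rfl)

/-- Every minimum in the recursion is at most `k`, so paths of rank `N` or more are never consulted.
Grid leaders are thus functions of finitely many integers. -/
theorem gridLeader_congr {a b : ℕ → ℕ → ℤ} {N r k : ℕ} (h : ∀ q ≤ r, ∀ j < N, a q j = b q j)
    (hk : k < N) : gridLeader a r k = gridLeader b r k := by
  induction r generalizing k with
  | zero => rfl
  | succ r ih =>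
    have ih' : ∀ j < N, gridLeader a r j = gridLeader b r j := fun j hj =>
      ih (fun q hq => h q (hq.trans (Nat.le_succ r))) hj
    have hpos : ∀ j < N, a (r + 1) (gridLeader a r j) = b (r + 1) (gridLeader b r j) :=
      fun j hj => by rw [ih' j hj, h _ le_rfl _ ((gridLeader_le b r j).trans_lt hj)]
    have hle : sInf {j | a (r + 1) (gridLeader a r j) = a (r + 1) (gridLeader a r k)} ≤ k :=
      Nat.sInf_le rfl
    have hle' : sInf {j | b (r + 1) (gridLeader b r j) = b (r + 1) (gridLeader b r k)} ≤ k :=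
      Nat.sInf_le rfl
    have hmem := Nat.sInf_mem
      (s := {j | a (r + 1) (gridLeader a r j) = a (r + 1) (gridLeader a r k)}) ⟨k, rfl⟩
    have hmem' := Nat.sInf_mem
      (s := {j | b (r + 1) (gridLeader b r j) = b (r + 1) (gridLeader b r k)}) ⟨k, rfl⟩
    have heq : sInf {j | a (r + 1) (gridLeader a r j) = a (r + 1) (gridLeader a r k)} =
        sInf {j | b (r + 1) (gridLeader b r j) = b (r + 1) (gridLeader b r k)} := by
      refine le_antisymm (Nat.sInf_le ?_) (Nat.sInf_le ?_)
      · rw [Set.mem_ofPred_eq, hpos _ (hle'.trans_lt hk), hpos k hk]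
        exact hmem'
      · rw [Set.mem_ofPred_eq, ← hpos _ (hle.trans_lt hk), ← hpos k hk]
        exact hmem
    simp only [gridLeader]
    rw [← heq, ih' _ (hle.trans_lt hk)]

include hx

/-- On a fine enough time grid no meeting is missed. -/
theorem exists_pos_gridLeader_eq (hinj : ∀ i j, x i 0 = x j 0 → i = j) (N : ℕ) :
    ∃ ε > 0, ∀ g : ℕ → ℝ≥0, g 0 = 0 → Monotone g → (∀ r, g (r + 1) < g r + ε) →
      ∀ r, ∀ k < N, gridLeader (fun q j => x j (g q)) r k = leader x (g r) k := by
  have hε : ∃ ε > 0, ∀ k < N, ∀ s t, t < s + ε →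
      (∀ j < k, rankedCoalescence x j s ≠ rankedCoalescence x k s) →
        rankedCoalescence x k t = x k t := by
    induction N with
    | zero => exact ⟨1, one_pos, fun k hk => absurd hk (Nat.not_lt_zero k)⟩
    | succ N ih =>
      obtain ⟨ε₁, h1, h1'⟩ := ih
      obtain ⟨ε₂, h2, h2'⟩ := exists_pos_eq_self hx N
      refine ⟨min ε₁ ε₂, lt_min h1 h2, fun k hk s t hts => ?_⟩
      rcases Nat.lt_succ_iff_lt_or_eq.1 hk with hk | rfl
      · exact h1' k hk s t (hts.trans_le (by gcongr; exact min_le_left _ _))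
      · exact h2' s t (hts.trans_le (by gcongr; exact min_le_right _ _))
  obtain ⟨ε, hε0, hε⟩ := hε
  refine ⟨ε, hε0, fun g hg0 hgm hg r => ?_⟩
  induction r with
  | zero =>
    intro k _
    have h := rankedCoalescence_leader x (g 0) k
    rw [hg0, rankedCoalescence_zero hx, rankedCoalescence_zero hx] at h
    rw [hg0, hinj _ _ h]
    rfl
  | succ r ih =>
    -- The leader at `g r` is with no particle of smaller rank at that time; by the choice of `ε`
    -- its own path still gives the position at `g (r + 1)`, even after a meeting in between.
    have hpos : ∀ k < N, x (leader x (g r) k) (g (r + 1)) = rankedCoalescence x k (g (r + 1)) := by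
      intro k hk
      rw [← hε _ ((leader_le rfl).trans_lt hk) (g r) (g (r + 1)) (hg r)
        fun j hj => rankedCoalescence_ne_of_lt_leader hj]
      exact rankedCoalescence_merged hx (rankedCoalescence_leader x (g r) k) (hgm (Nat.le_succ r))
    intro k hk
    have hle : leader x (g (r + 1)) k ≤ k := leader_le rfl
    have heq : sInf {j | x (gridLeader (fun q j => x j (g q)) r j) (g (r + 1)) =
        x (gridLeader (fun q j => x j (g q)) r k) (g (r + 1))} = leader x (g (r + 1)) k := by
      refine le_antisymm (Nat.sInf_le ?_) (le_csInf ⟨k, rfl⟩ fun j hj => ?_)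
      · rw [Set.mem_ofPred_eq, ih k hk, ih _ (hle.trans_lt hk), hpos k hk,
          hpos _ (hle.trans_lt hk), rankedCoalescence_leader]
      · rcases lt_or_ge j N with hjN | hjN
        · rw [Set.mem_ofPred_eq, ih _ hjN, ih k hk, hpos _ hjN, hpos k hk] at hj
          exact leader_le hj
        · exact hle.trans (hk.le.trans hjN)
    simp only [gridLeader]
    rw [heq, ih _ (hle.trans_lt hk)]
    refine le_antisymm (leader_le rfl) (leader_le ?_)
    rw [rankedCoalescence_merged hx (rankedCoalescence_leader x (g r) _) (hgm (Nat.le_succ r)),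
      rankedCoalescence_leader]

end Paths

/-! ### Harmonicity and bounds for the matrix entries -/

namespace TransitionFunction

variable (P : TransitionFunction)

theorem prob_le_one {s t : ℝ≥0} (hst : s ≤ t) (x y : ℤ) : P.prob s t x y ≤ 1 :=
  le_hasSum (P.hasSum_one s t hst x) y fun z _ => P.nonneg s t hst x z

theorem summable_subtype {s t : ℝ≥0} (hst : s ≤ t) (x : ℤ) (S : Set ℤ) :
    Summable fun z : S => P.prob s t x z :=
  (P.hasSum_one s t hst x).summable.subtype S

theorem cumulative_nonneg {s t : ℝ≥0} (hst : s ≤ t) (x y : ℤ) :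
    0 ≤ cumulative (P.prob s t) x y :=
  tsum_nonneg fun z => P.nonneg s t hst x z

theorem cumulative_le_one {s t : ℝ≥0} (hst : s ≤ t) (x y : ℤ) :
    cumulative (P.prob s t) x y ≤ 1 := by
  rw [← (P.hasSum_one s t hst x).tsum_eq]
  exact (P.hasSum_one s t hst x).summable.tsum_subtype_le _ (Set.Iic y) (P.nonneg s t hst x)

theorem hasSum_mul_const {s t : ℝ≥0} (hst : s ≤ t) (x : ℤ) (c : ℝ) :
    HasSum (fun z => P.prob s t x z * c) c := by
  simpa using (P.hasSum_one s t hst x).mul_right c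

/-- Chapman–Kolmogorov summed over the endpoints `≤ y`; nonnegativity permits exchanging the sums.
-/
theorem hasSum_mul_cumulative {r s t : ℝ≥0} (hrs : r ≤ s) (hst : s ≤ t) (x y : ℤ) :
    HasSum (fun z => P.prob r s x z * cumulative (P.prob s t) z y)
      (cumulative (P.prob r t) x y) := by
  have hsum : Summable fun q : Set.Iic y × ℤ => P.prob r s x q.2 * P.prob s t q.2 q.1 := by
    rw [summable_prod_of_nonneg fun q => mul_nonneg (P.nonneg r s hrs _ _) (P.nonneg s t hst _ _)]
    refine ⟨fun w => (P.chapman_kolmogorov r s t hrs hst x w).summable, ?_⟩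
    simp only [(P.chapman_kolmogorov r s t hrs hst x _).tsum_eq]
    exact P.summable_subtype (hrs.trans hst) x _
  have h := hsum.prod_symm.prod.hasSum
  simp only [Prod.fst_swap, Prod.snd_swap] at h
  rw [← Summable.tsum_comm (f := fun (z : ℤ) (w : Set.Iic y) =>
    P.prob r s x z * P.prob s t z w) hsum.prod_symm] at h
  simp only [tsum_mul_left, (P.chapman_kolmogorov r s t hrs hst x _).tsum_eq] at h
  exact h

variable {ι B : Type*} [LinearOrder ι]

theorem abs_coalescenceMatrix_le_one {s t : ℝ≥0} (hst : s ≤ t) (z : ι → ℤ) (block : ι → B)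
    (y : B → ℤ) (i j : ι) : |coalescenceMatrix (P.prob s t) z block y i j| ≤ 1 := by
  by_cases hj : ∃ j' < j, block j' = block j
  · rw [coalescenceMatrix_apply_of_not_first _ _ _ _ hj, abs_le]
    have h0 := P.cumulative_nonneg hst (z i) (y (block j))
    have h1 := P.cumulative_le_one hst (z i) (y (block j))
    split_ifs <;> constructor <;> linarith
  · rw [coalescenceMatrix_apply_of_first _ _ _ _ hj, abs_of_nonneg (P.nonneg s t hst _ _)]
    exact P.prob_le_one hst _ _

variable [Fintype ι]

theorem abs_det_coalescenceMatrix_le {s t : ℝ≥0} (hst : s ≤ t) (z : ι → ℤ) (block : ι → B)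
    (y : B → ℤ) :
    |(coalescenceMatrix (P.prob s t) z block y).det| ≤ (Fintype.card ι).factorial := by
  simpa using Matrix.det_le (abv := AbsoluteValue.abs)
    (P.abs_coalescenceMatrix_le_one hst z block y)

theorem abs_reducedMatrix_le_one {K : Type*} {s t : ℝ≥0} (hst : s ≤ t) (κ : ι → K) (z : K → ℤ)
    (block : ι → B) (y : B → ℤ) (i j : ι) :
    |reducedMatrix (P.prob s t) κ z block y i j| ≤ 1 := by
  simp only [reducedMatrix, Matrix.of_apply]
  split_ifs <;> first | exact P.abs_coalescenceMatrix_le_one hst _ _ _ _ _ | norm_num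

/-- The rows of the reduced matrix are space-time harmonic. -/
theorem hasSum_mul_reducedMatrix {K : Type*} {r s t : ℝ≥0} (hrs : r ≤ s) (hst : s ≤ t) (x : ℤ)
    (κ : ι → K) (block : ι → B) (y : B → ℤ) (i j : ι) :
    HasSum (fun z => P.prob r s x z * reducedMatrix (P.prob s t) κ (fun _ => z) block y i j)
      (reducedMatrix (P.prob r t) κ (fun _ => x) block y i j) := by
  simp only [reducedMatrix, Matrix.of_apply]
  split_ifs with h1 hj h3 h4 h4
  · by_cases hj : ∃ j' < j, block j' = block j
    · simp only [coalescenceMatrix_apply_of_not_first _ _ _ _ hj, mul_sub]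
      exact (P.hasSum_mul_cumulative hrs hst _ _).sub (P.hasSum_mul_const hrs _ _)
    · simp only [coalescenceMatrix_apply_of_first _ _ _ _ hj]
      exact P.chapman_kolmogorov r s t hrs hst _ _
  all_goals exact P.hasSum_mul_const hrs _ _

-- Products of harmonic functions of one path are not harmonic in general, but here only the factor
-- `l` may vary with `z`, and each constant factor equals its own mean.
omit [Fintype ι] in
theorem hasSum_mul_prod_of_constant {s t : ℝ≥0} (hst : s ≤ t) (x : ℤ) (S : Finset ι)
    (φ : ι → ℤ → ℝ) (ψ : ι → ℝ) (h : ∀ i ∈ S, HasSum (fun z => P.prob s t x z * φ i z) (ψ i)) (l : ι)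
    (hl : ∀ i ∈ S, i ≠ l → ∃ c, ∀ z, φ i z = c) :
    HasSum (fun z => P.prob s t x z * ∏ i ∈ S, φ i z) (∏ i ∈ S, ψ i) := by
  have hc : ∀ i ∈ S, i ≠ l → ∀ z, φ i z = ψ i := by
    intro i hi hil z
    obtain ⟨c, hc⟩ := hl i hi hil
    have h1 := h i hi
    simp only [hc] at h1 ⊢
    exact (P.hasSum_mul_const hst x c).unique h1
  by_cases hlS : l ∈ S
  · have hprod : ∀ z, ∏ i ∈ S, φ i z = φ l z * ∏ i ∈ S.erase l, ψ i := fun z => by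
      rw [← Finset.mul_prod_erase S _ hlS]
      congr 1
      exact Finset.prod_congr rfl fun i hi =>
        hc i (Finset.mem_of_mem_erase hi) (Finset.ne_of_mem_erase hi) z
    simp only [hprod, ← mul_assoc]
    rw [← Finset.mul_prod_erase S _ hlS]
    exact (h l hlS).mul_right _
  · have hprod : ∀ z, ∏ i ∈ S, φ i z = ∏ i ∈ S, ψ i := fun z =>
      Finset.prod_congr rfl fun i hi => hc i hi (fun he => hlS (he ▸ hi)) z
    simp only [hprod]
    exact P.hasSum_mul_const hst x _

end TransitionFunction

/-! ### One time step with fixed driving paths -/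

namespace IsIndepMarkovFamily

variable {Ω : Type*} [MeasurableSpace Ω] {μ : Measure Ω} [IsProbabilityMeasure μ]
  {P : TransitionFunction} {X : ℤ → ℝ≥0 → Ω → ℤ} (hX : IsIndepMarkovFamily P X μ)
  {g : ℕ → ℝ≥0}

include hX

omit [IsProbabilityMeasure μ] in
theorem eventually_eq (x : ℤ) (t : ℝ≥0) (ω : Ω) : ∀ᶠ s in 𝓝[≥] t, X x s ω = X x t ω := by
  have h : Tendsto (fun s => X x s ω) (𝓝[≥] t) (𝓝 (X x t ω)) := hX.rightContinuous x ω t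
  rwa [nhds_discrete, tendsto_pure] at h

omit [IsProbabilityMeasure μ] in
theorem measurableSet_history (x : ℤ) (g : ℕ → ℝ≥0) (r : ℕ) (h : ℕ → ℤ) :
    MeasurableSet {ω | ∀ q ≤ r, X x (g q) ω = h q} := by
  simp only [Set.ofPred_forall]
  exact MeasurableSet.iInter fun q => MeasurableSet.iInter fun _ =>
    hX.measurable x (g q) (measurableSet_singleton (h q))

theorem setIntegral_history (hg : Monotone g) {r : ℕ} {t : ℝ≥0} (ht : g r ≤ t) (x : ℤ) (h : ℕ → ℤ)
    {φ : ℤ → ℝ} {C c : ℝ} (hφ : ∀ z, |φ z| ≤ C)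
    (hc : HasSum (fun z => P.prob (g r) t (h r) z * φ z) c) :
    ∫ ω in {ω | ∀ q ≤ r, X x (g q) ω = h q}, φ (X x t ω) ∂μ =
      μ.real {ω | ∀ q ≤ r, X x (g q) ω = h q} * c := by
  set A := {ω | ∀ q ≤ r, X x (g q) ω = h q} with hA
  have hAm : MeasurableSet A := hX.measurableSet_history x g r h
  have hpast : MeasurableSet[⨆ q : Set.Iic (g r), MeasurableSpace.comap (X x q) ⊤] A := by
    simp only [hA, Set.ofPred_forall]
    exact MeasurableSet.iInter fun q => MeasurableSet.iInter fun hq =>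
      le_iSup (fun q : Set.Iic (g r) => MeasurableSpace.comap (X x q) ⊤) ⟨g q, hg hq⟩ _
        ⟨{h q}, trivial, rfl⟩
  have hunion : A = ⋃ z, A ∩ X x t ⁻¹' {z} := by
    ext ω; simp
  have hm : ∀ z, MeasurableSet (A ∩ X x t ⁻¹' {z}) := fun z =>
    hAm.inter (hX.measurable x t (measurableSet_singleton z))
  have hint : Integrable (fun ω => φ (X x t ω)) μ :=
    Integrable.of_bound ((measurable_of_countable φ).comp (hX.measurable x t)).aestronglyMeasurable
      C (ae_of_all _ fun ω => hφ _)
  have hsum := hasSum_integral_iUnion (f := fun ω => φ (X x t ω)) (μ := μ) hm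
    (fun z w hzw => Set.disjoint_left.2 fun ω h1 h2 => hzw (h1.2.symm.trans h2.2))
    hint.integrableOn
  rw [← hunion] at hsum
  refine hsum.unique ?_
  convert! hc.mul_left (μ.real A) using 2 with z
  rw [setIntegral_congr_fun (hm z) (g := fun _ => φ z) fun ω hω => congrArg φ hω.2,
    setIntegral_const, smul_eq_mul, ← mul_assoc]
  congr 1
  have h1 := hX.markov x (g r) t ht (h r) z A hpast
  have h2 : A ∩ {ω | X x (g r) ω = h r} = A :=
    Set.inter_eq_left.2 fun ω hω => hω r le_rfl
  rw [h2] at h1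
  rw [← h1]
  congr 1
  ext ω
  exact ⟨fun hω => ⟨hω.1, hω.1 r le_rfl, hω.2⟩, fun hω => ⟨hω.1, hω.2.2⟩⟩

theorem setIntegral_joint_history (hg : Monotone g) {r : ℕ} {t : ℝ≥0} (ht : g r ≤ t) {N : ℕ}
    {e : Fin N → ℤ} (he : Function.Injective e) (h : ℕ → Fin N → ℤ)
    {φ : Fin N → ℤ → ℝ} {C : ℝ} {c : Fin N → ℝ} (hφ : ∀ j z, |φ j z| ≤ C)
    (hc : ∀ j, HasSum (fun z => P.prob (g r) t (h r j) z * φ j z) (c j)) :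
    ∫ ω in {ω | ∀ j, ∀ q ≤ r, X (e j) (g q) ω = h q j}, ∏ j, φ j (X (e j) t ω) ∂μ =
      μ.real {ω | ∀ j, ∀ q ≤ r, X (e j) (g q) ω = h q j} * ∏ j, c j := by
  have key : ∀ (φ : Fin N → ℤ → ℝ) (C : ℝ) (c : Fin N → ℝ), (∀ j z, |φ j z| ≤ C) →
      (∀ j, HasSum (fun z => P.prob (g r) t (h r j) z * φ j z) (c j)) →
      ∫ ω in {ω | ∀ j, ∀ q ≤ r, X (e j) (g q) ω = h q j}, ∏ j, φ j (X (e j) t ω) ∂μ =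
        ∏ j, μ.real {ω | ∀ q ≤ r, X (e j) (g q) ω = h q j} * c j := by
    intro φ C c hφ hc
    have hm : ∀ j, MeasurableSet {p : ℝ≥0 → ℤ | ∀ q ≤ r, p (g q) = h q j} := fun j => by
      simp only [Set.ofPred_forall]
      exact MeasurableSet.iInter fun q => MeasurableSet.iInter fun _ =>
        measurableSet_eq_fun (measurable_pi_apply (g q)) measurable_const
    have hAm : MeasurableSet {ω | ∀ j, ∀ q ≤ r, X (e j) (g q) ω = h q j} := by
      rw [Set.ofPred_forall]
      exact MeasurableSet.iInter fun j => hX.measurableSet_history (e j) g r fun q => h q j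
    have hind := (hX.indep.precomp he).integral_fun_prod_comp (𝕜 := ℝ)
      (f := fun j => {p : ℝ≥0 → ℤ | ∀ q ≤ r, p (g q) = h q j}.indicator fun p => φ j (p t))
      (fun j => (measurable_pi_lambda _ fun t => hX.measurable (e j) t).aemeasurable)
      (fun j => (((measurable_of_countable (φ j)).comp
        (measurable_pi_apply t)).indicator (hm j)).aestronglyMeasurable)
    rw [← integral_indicator hAm]
    convert hind using 1
    · congr 1
      ext ω
      by_cases hω : ∀ j, ∀ q ≤ r, X (e j) (g q) ω = h q j
      · rw [Set.indicator_of_mem (by exact hω)]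
        exact Finset.prod_congr rfl fun j _ => by rw [Set.indicator_of_mem (by exact hω j)]
      · rw [Set.indicator_of_notMem (by exact hω)]
        push Not at hω
        obtain ⟨j, q, hq, hne⟩ := hω
        refine (Finset.prod_eq_zero (Finset.mem_univ j) ?_).symm
        rw [Set.indicator_of_notMem]
        exact fun hmem => hne (hmem q hq)
    · refine Finset.prod_congr rfl fun j _ => ?_
      rw [← hX.setIntegral_history hg ht (e j) (fun q => h q j) (hφ j) (hc j),
        ← integral_indicator (hX.measurableSet_history (e j) g r fun q => h q j)]
      rfl
  rw [key φ C c hφ hc, Finset.prod_mul_distrib]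
  congr 1
  -- The test functions `1` factor the probability of the joint history itself.
  have h1 := key (fun _ _ => 1) 1 (fun _ => 1) (by simp) fun j => P.hasSum_mul_const ht _ _
  simp only [Finset.prod_const_one, mul_one, integral_const, smul_eq_mul, measureReal_restrict_apply,
    MeasurableSet.univ, Set.univ_inter] at h1
  exact h1.symm

variable {ι B : Type*} [LinearOrder ι] [Fintype ι]

theorem setIntegral_det (hg : Monotone g) {r : ℕ} {t T : ℝ≥0} (ht : g r ≤ t) (hT : t ≤ T) {N : ℕ}
    {e : Fin N → ℤ} (he : Function.Injective e) (h : ℕ → Fin N → ℤ) (κ : ι → Fin N)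
    (block : ι → B) (y : B → ℤ) :
    ∫ ω in {ω | ∀ j, ∀ q ≤ r, X (e j) (g q) ω = h q j},
        (coalescenceMatrix (P.prob t T) (fun i => X (e (κ i)) t ω) block y).det ∂μ =
      μ.real {ω | ∀ j, ∀ q ≤ r, X (e j) (g q) ω = h q j} *
        (coalescenceMatrix (P.prob (g r) T) (fun i => h r (κ i)) block y).det := by
  -- Leibniz expansion of the reduced determinant, with the factors grouped by the path `j` that
  -- drives their rows.
  have hexp : ∀ (s : ℝ≥0) (z : Fin N → ℤ),
      (coalescenceMatrix (P.prob s T) (fun i => z (κ i)) block y).det =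
        ∑ σ : Equiv.Perm ι, (Equiv.Perm.sign σ : ℝ) * ∏ j, ∏ i with κ i = j,
          reducedMatrix (P.prob s T) κ (fun _ => z j) block y i (σ i) := by
    intro s z
    rw [show (fun i => z (κ i)) = z ∘ κ from rfl, ← det_reducedMatrix, ← Matrix.det_transpose,
      Matrix.det_apply']
    refine Finset.sum_congr rfl fun σ _ => ?_
    congr 1
    rw [← Finset.prod_fiberwise Finset.univ κ]
    refine Finset.prod_congr rfl fun j _ => Finset.prod_congr rfl fun i hi => ?_
    have hi : κ i = j := by simpa using hi
    simp [reducedMatrix, coalescenceMatrix, hi]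
  have hbound : ∀ (σ : Equiv.Perm ι) (j : Fin N) (z : ℤ), |∏ i with κ i = j,
      reducedMatrix (P.prob t T) κ (fun _ => z) block y i (σ i)| ≤ 1 := by
    intro σ j z
    rw [Finset.abs_prod]
    exact Finset.prod_le_one (fun _ _ => abs_nonneg _)
      fun _ _ => P.abs_reducedMatrix_le_one hT _ _ _ _ _ _
  have hharm : ∀ (σ : Equiv.Perm ι) (j : Fin N), HasSum (fun z => P.prob (g r) t (h r j) z *
      ∏ i with κ i = j, reducedMatrix (P.prob t T) κ (fun _ => z) block y i (σ i))
      (∏ i with κ i = j, reducedMatrix (P.prob (g r) T) κ (fun _ => h r j) block y i (σ i)) := by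
    intro σ j
    -- A path driving no row contributes an empty product; otherwise only the row `classMax κ l` is
    -- nonconstant.
    rcases isEmpty_or_nonempty {i // κ i = j} with hem | ⟨⟨l, hl⟩⟩
    · have : (Finset.univ.filter fun i => κ i = j) = ∅ :=
        Finset.filter_eq_empty_iff.2 fun i _ hi => hem.false ⟨i, hi⟩
      simpa [this] using P.hasSum_one (g r) t ht (h r j)
    · refine P.hasSum_mul_prod_of_constant ht _ _ _ _
        (fun i _ => P.hasSum_mul_reducedMatrix ht hT _ _ _ _ _ _) (classMax κ l) fun i hi hil => ?_
      have hi : κ i = j := by simpa using hi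
      have hne : classMax κ i ≠ i := by
        rw [classMax_congr (hi.trans hl.symm)]
        exact hil.symm
      simp only [reducedMatrix, Matrix.of_apply, if_neg hne]
      exact ⟨_, fun _ => rfl⟩
  have hint : ∀ σ : Equiv.Perm ι, Integrable (fun ω => ∏ j, ∏ i with κ i = j,
      reducedMatrix (P.prob t T) κ (fun _ => X (e j) t ω) block y i (σ i)) μ := by
    intro σ
    refine Integrable.of_bound (C := 1) (Measurable.aestronglyMeasurable ?_) (ae_of_all _ fun ω => ?_)
    · exact Finset.measurable_fun_prod _ fun j _ => (measurable_of_countable fun z =>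
        ∏ i with κ i = j, reducedMatrix (P.prob t T) κ (fun _ => z) block y i (σ i)).comp
          (hX.measurable (e j) t)
    · rw [Real.norm_eq_abs, Finset.abs_prod]
      exact Finset.prod_le_one (fun _ _ => abs_nonneg _) fun j _ => hbound σ j _
  simp only [hexp _ (h r), fun ω => hexp t fun j => X (e j) t ω]
  rw [integral_finsetSum _ fun σ _ => ((hint σ).const_mul _).integrableOn, Finset.mul_sum]
  refine Finset.sum_congr rfl fun σ _ => ?_
  rw [integral_const_mul, hX.setIntegral_joint_history hg ht he h (hbound σ) (hharm σ)]
  ring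

end IsIndepMarkovFamily

/-! ### Conservation of the mean and the law of the endpoints -/

namespace IsIndepMarkovFamily

variable {Ω : Type*} [MeasurableSpace Ω] {μ : Measure Ω} [IsProbabilityMeasure μ]
  {P : TransitionFunction} {X : ℤ → ℝ≥0 → Ω → ℤ} (hX : IsIndepMarkovFamily P X μ)
  {g : ℕ → ℝ≥0} {e : ℕ → ℤ}

include hX

-- By `gridLeader_congr` the position is a function on a countable type of finite histories; the
-- padding by `0` is never read.
omit [IsProbabilityMeasure μ] in
theorem measurable_gridLeader_position (g : ℕ → ℝ≥0) (e : ℕ → ℤ) (r k : ℕ) :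
    Measurable fun ω => X (e (gridLeader (fun q j => X (e j) (g q) ω) r k)) (g r) ω := by
  let ext : (Fin (r + 1) → Fin (k + 1) → ℤ) → ℕ → ℕ → ℤ := fun h q j =>
    if hq : q < r + 1 then if hj : j < k + 1 then h ⟨q, hq⟩ ⟨j, hj⟩ else 0 else 0
  have hmeas : Measurable fun ω => fun (q : Fin (r + 1)) (j : Fin (k + 1)) => X (e j) (g q) ω :=
    measurable_pi_lambda _ fun q => measurable_pi_lambda _ fun j => hX.measurable (e j) (g q)
  convert! (measurable_of_countable fun h : Fin (r + 1) → Fin (k + 1) → ℤ =>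
    ext h r (gridLeader (ext h) r k)).comp hmeas using 2 with ω
  have hK : gridLeader (ext fun q j => X (e j) (g q) ω) r k =
      gridLeader (fun q j => X (e j) (g q) ω) r k :=
    gridLeader_congr (N := k + 1) (fun q hq j hj => by
      simp only [ext, dif_pos (Nat.lt_succ_of_le hq), dif_pos hj])
      (Nat.lt_succ_self k)
  simp only [Function.comp, hK]
  simp only [ext, dif_pos (Nat.lt_succ_self r), dif_pos (Nat.lt_succ_of_le (gridLeader_le _ r k))]

variable {ι B : Type*} [LinearOrder ι] [Fintype ι]

omit [IsProbabilityMeasure μ] in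
theorem measurable_det_gridLeader (g : ℕ → ℝ≥0) (e : ℕ → ℤ) (p : ℤ → ℤ → ℝ) (r : ℕ) (ρ : ι → ℕ)
    (block : ι → B) (y : B → ℤ) :
    Measurable fun ω => (coalescenceMatrix p
      (fun i => X (e (gridLeader (fun q j => X (e j) (g q) ω) r (ρ i))) (g r) ω) block y).det :=
  (measurable_of_countable fun z : ι → ℤ => (coalescenceMatrix p z block y).det).comp
    (measurable_pi_lambda _ fun i => hX.measurable_gridLeader_position g e r (ρ i))

theorem integrable_det_gridLeader (g : ℕ → ℝ≥0) (e : ℕ → ℤ) {s T : ℝ≥0} (hs : s ≤ T) (r : ℕ)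
    (ρ : ι → ℕ) (block : ι → B) (y : B → ℤ) :
    Integrable (fun ω => (coalescenceMatrix (P.prob s T)
      (fun i => X (e (gridLeader (fun q j => X (e j) (g q) ω) r (ρ i))) (g r) ω) block y).det) μ :=
  Integrable.of_bound (hX.measurable_det_gridLeader g e _ r ρ block y).aestronglyMeasurable _
    (ae_of_all _ fun _ => P.abs_det_coalescenceMatrix_le hs _ block y)

-- The joint histories of `N` paths at the grid times up to index `r` partition `Ω` into countably
-- many cells.
omit [IsProbabilityMeasure μ] in
theorem integral_eq_of_setIntegral_history (g : ℕ → ℝ≥0) {N : ℕ} (e : Fin N → ℤ) (r : ℕ)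
    {F G : Ω → ℝ} (hF : Integrable F μ) (hG : Integrable G μ)
    (h : ∀ h : ℕ → Fin N → ℤ,
      ∫ ω in {ω | ∀ j, ∀ q ≤ r, X (e j) (g q) ω = h q j}, F ω ∂μ =
        ∫ ω in {ω | ∀ j, ∀ q ≤ r, X (e j) (g q) ω = h q j}, G ω ∂μ) :
    ∫ ω, F ω ∂μ = ∫ ω, G ω ∂μ := by
  let ext : (Fin (r + 1) → Fin N → ℤ) → ℕ → Fin N → ℤ := fun h q j =>
    if hq : q < r + 1 then h ⟨q, hq⟩ j else 0
  let A : (Fin (r + 1) → Fin N → ℤ) → Set Ω := fun h =>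
    {ω | ∀ j, ∀ q ≤ r, X (e j) (g q) ω = ext h q j}
  have hm : ∀ h, MeasurableSet (A h) := fun h => by
    simp only [A]
    rw [Set.ofPred_forall]
    exact MeasurableSet.iInter fun j => hX.measurableSet_history (e j) g r fun q => ext h q j
  have hd : Pairwise (Function.onFun Disjoint A) := by
    intro h h' hne
    refine Set.disjoint_left.2 fun ω h1 h2 => hne ?_
    funext q j
    have h3 := (h1 j q (Nat.le_of_lt_succ q.2)).symm.trans (h2 j q (Nat.le_of_lt_succ q.2))
    simpa only [ext, dif_pos q.2] using h3
  have hu : ⋃ h, A h = Set.univ := by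
    refine Set.eq_univ_of_forall fun ω => Set.mem_iUnion.2
      ⟨fun q j => X (e j) (g q) ω, fun j q hq => ?_⟩
    simp only [ext, dif_pos (Nat.lt_succ_of_le hq)]
  rw [← setIntegral_univ (f := F), ← setIntegral_univ (f := G), ← hu,
    integral_iUnion hm hd hF.integrableOn, integral_iUnion hm hd hG.integrableOn]
  exact tsum_congr fun h' => h (ext h')

/-- On a history cell the leaders at step `r` are deterministic, so `setIntegral_det` applies with a
fixed `κ`. Passing to the leaders at step `r + 1` changes paths but not positions. -/
theorem integral_det_gridLeader_succ (hg : Monotone g) (he : Function.Injective e) {r : ℕ} {T : ℝ≥0}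
    (hT : g (r + 1) ≤ T) (ρ : ι → ℕ) (block : ι → B) (y : B → ℤ) :
    ∫ ω, (coalescenceMatrix (P.prob (g (r + 1)) T) (fun i =>
      X (e (gridLeader (fun q j => X (e j) (g q) ω) (r + 1) (ρ i))) (g (r + 1)) ω) block y).det ∂μ =
    ∫ ω, (coalescenceMatrix (P.prob (g r) T) (fun i =>
      X (e (gridLeader (fun q j => X (e j) (g q) ω) r (ρ i))) (g r) ω) block y).det ∂μ := by
  have hr : g r ≤ g (r + 1) := hg (Nat.le_succ r)
  set N := Finset.univ.sup ρ + 1 with hN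
  have hρ : ∀ i, ρ i < N := fun i => Nat.lt_succ_of_le (Finset.le_sup (Finset.mem_univ i))
  refine hX.integral_eq_of_setIntegral_history g (fun j : Fin N => e j) r
    (hX.integrable_det_gridLeader g e hT (r + 1) ρ block y)
    (hX.integrable_det_gridLeader g e (hr.trans hT) r ρ block y) fun h => ?_
  set A := {ω | ∀ j : Fin N, ∀ q ≤ r, X (e j) (g q) ω = h q j} with hA
  have hAm : MeasurableSet A := by
    rw [hA, Set.ofPred_forall]
    exact MeasurableSet.iInter fun j => hX.measurableSet_history (e j) g r fun q => h q j
  let b : ℕ → ℕ → ℤ := fun q j => if hj : j < N then h q ⟨j, hj⟩ else 0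
  have hK : ∀ ω ∈ A, ∀ i, gridLeader (fun q j => X (e j) (g q) ω) r (ρ i) =
      gridLeader b r (ρ i) := fun ω hω i =>
    gridLeader_congr (fun q hq j hj => by simpa [b, hj] using hω ⟨j, hj⟩ q hq) (hρ i)
  let κ : ι → Fin N := fun i => ⟨gridLeader b r (ρ i), (gridLeader_le b r _).trans_lt (hρ i)⟩
  have hleft := hX.setIntegral_det hg hr hT (e := fun j : Fin N => e j)
    (he.comp Fin.val_injective) h κ block y
  rw [setIntegral_congr_fun hAm (g := fun ω => (coalescenceMatrix (P.prob (g (r + 1)) T)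
      (fun i => X (e (κ i)) (g (r + 1)) ω) block y).det), hleft,
    setIntegral_congr_fun hAm (g := fun _ => (coalescenceMatrix (P.prob (g r) T)
      (fun i => h r (κ i)) block y).det), setIntegral_const, smul_eq_mul]
  · intro ω hω
    simp only [hK ω hω]
    congr 2
    funext i
    exact hω (κ i) r le_rfl
  · intro ω hω
    simp only
    congr 2
    funext i
    rw [← show gridLeader (fun q j => X (e j) (g q) ω) r (ρ i) = κ i from hK ω hω i]
    exact gridLeader_succ_position (fun q j => X (e j) (g q) ω) r (ρ i)

theorem integral_det_gridLeader (hg : Monotone g) (hg0 : g 0 = 0) (he : Function.Injective e) (r : ℕ)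
    {T : ℝ≥0} (hT : g r ≤ T) (ρ : ι → ℕ) (block : ι → B) (y : B → ℤ) :
    ∫ ω, (coalescenceMatrix (P.prob (g r) T) (fun i =>
      X (e (gridLeader (fun q j => X (e j) (g q) ω) r (ρ i))) (g r) ω) block y).det ∂μ =
    (coalescenceMatrix (P.prob 0 T) (fun i => e (ρ i)) block y).det := by
  induction r with
  | zero => simp [gridLeader, hg0, hX.start]
  | succ r ih =>
    rw [hX.integral_det_gridLeader_succ hg he hT]
    exact ih ((hg (Nat.le_succ r)).trans hT)

/-- The mean of the determinant at the final positions of the coalescing particles is the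
determinant at their starting positions. -/
theorem integral_det_rankedCoalescence (he : Function.Injective e) (T : ℝ≥0) (ρ : ι → ℕ)
    (block : ι → B) (y : B → ℤ) :
    AEStronglyMeasurable (fun ω => (coalescenceMatrix (P.prob T T) (fun i =>
        rankedCoalescence (fun j t => X (e j) t ω) (ρ i) T) block y).det) μ ∧
      ∫ ω, (coalescenceMatrix (P.prob T T) (fun i =>
        rankedCoalescence (fun j t => X (e j) t ω) (ρ i) T) block y).det ∂μ =
      (coalescenceMatrix (P.prob 0 T) (fun i => e (ρ i)) block y).det := by
  -- Equal steps `T / (n + 1)`, frozen at `T` from index `n + 1` on.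
  let g : ℕ → ℕ → ℝ≥0 := fun n r => T * (min r (n + 1) : ℕ) / (n + 1 : ℕ)
  have hg : ∀ n, Monotone (g n) := fun n r s hrs => by
    simp only [g]
    gcongr
  have hg0 : ∀ n, g n 0 = 0 := fun n => by simp [g]
  have hgT : ∀ n, g n (n + 1) = T := fun n => by
    simp only [g, min_self]
    exact mul_div_cancel_right₀ T (by positivity)
  have hstep : ∀ n r, g n (r + 1) ≤ g n r + T / (n + 1 : ℕ) := fun n r => by
    simp only [g]
    rw [← add_div]
    gcongr
    rw [← mul_add_one]
    gcongr
    norm_cast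
    omega
  have hmesh : Tendsto (fun n : ℕ => T / (n + 1 : ℕ)) atTop (𝓝 0) :=
    (tendsto_const_div_atTop_nhds_zero_nat T).comp (tendsto_add_atTop_nat 1)
  -- For each `ω` the sequence is eventually constant: the mesh drops below the `ε` of that `ω`.
  have hlim : ∀ ω, Tendsto (fun n : ℕ => (coalescenceMatrix (P.prob T T) (fun i =>
      X (e (gridLeader (fun q j => X (e j) (g n q) ω) (n + 1) (ρ i))) (g n (n + 1)) ω) block y).det)
      atTop (𝓝 (coalescenceMatrix (P.prob T T) (fun i =>
        rankedCoalescence (fun j t => X (e j) t ω) (ρ i) T) block y).det) := by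
    intro ω
    have hx : ∀ k t, ∀ᶠ s in 𝓝[≥] t, X (e k) s ω = X (e k) t ω := fun k t =>
      hX.eventually_eq (e k) t ω
    obtain ⟨ε, hε, hgrid⟩ := exists_pos_gridLeader_eq (x := fun j t => X (e j) t ω) hx
      (fun i j hij => he (by simpa [hX.start] using hij)) (Finset.univ.sup ρ + 1)
    refine tendsto_const_nhds.congr' ?_
    filter_upwards [hmesh.eventually (gt_mem_nhds hε)] with n hn
    congr 2
    funext i
    rw [hgrid (g n) (hg0 n) (hg n) (fun r => (hstep n r).trans_lt (by gcongr)) (n + 1) (ρ i)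
      (Nat.lt_succ_of_le (Finset.le_sup (Finset.mem_univ i))), hgT]
    rw [← rankedCoalescence_leader]
    exact rankedCoalescence_leader_eq_self (x := fun j t => X (e j) t ω) hx (ρ i) le_rfl
  have hmeas : ∀ n, AEStronglyMeasurable (fun ω => (coalescenceMatrix (P.prob T T) (fun i =>
      X (e (gridLeader (fun q j => X (e j) (g n q) ω) (n + 1) (ρ i))) (g n (n + 1)) ω)
      block y).det) μ := fun n =>
    (hX.measurable_det_gridLeader (g n) e _ (n + 1) ρ block y).aestronglyMeasurable
  refine ⟨aestronglyMeasurable_of_tendsto_ae atTop hmeas (ae_of_all _ hlim), ?_⟩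
  refine tendsto_nhds_unique (tendsto_integral_of_dominated_convergence
    (fun _ => ((Fintype.card ι).factorial : ℝ)) hmeas (integrable_const _)
    (fun n => ae_of_all _ fun ω => P.abs_det_coalescenceMatrix_le le_rfl _ block y)
    (ae_of_all _ hlim)) ?_
  refine tendsto_const_nhds.congr fun n => ?_
  have h := hX.integral_det_gridLeader (hg n) (hg0 n) he (n + 1) (hgT n).le ρ block y
  rw [← h, hgT n]

omit [IsProbabilityMeasure μ] in
theorem ae_coalescing_monotone (hskip : SkipFree X μ) (e : ℕ ≃ ℤ) (T : ℝ≥0) :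
    ∀ᵐ ω ∂μ, Monotone fun i => coalescing e (fun j t => X j t ω) i T := by
  have hskip' : ∀ᵐ ω ∂μ, ∀ x y : ℤ, x < y → ∀ t, X y t ω < X x t ω →
      ∃ s ≤ t, X x s ω = X y s ω :=
    ae_all_iff.2 fun x => ae_all_iff.2 fun y => eventually_imp_distrib_left.2 (hskip x y)
  filter_upwards [hskip'] with ω hω a b hab
  refine rankedCoalescence_le_of_skipFree (x := fun n t => X (e n) t ω)
    (fun k t => hX.eventually_eq (e k) t ω) (fun i j hij t ht => ?_) ?_ T
  · exact hω _ _ (by simpa [hX.start] using hij) t ht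
  · simpa [hX.start] using hab

/-- The law of the final positions of finitely many particles of the coalescing system. -/
theorem measureReal_coalescing_eq (hskip : SkipFree X μ) (e : ℕ ≃ ℤ) (T : ℝ≥0) {u : ι → ℤ}
    (hu : Monotone u) {block : ι → B} {y : B → ℤ} (hv : Monotone fun i => y (block i))
    (hb : ∀ i j, y (block i) = y (block j) → block i = block j) :
    μ.real {ω | ∀ i, coalescing e (fun j t => X j t ω) (u i) T = y (block i)} =
      (coalescenceMatrix (P.prob 0 T) u block y).det := by
  classical
  obtain ⟨hm, hI⟩ := hX.integral_det_rankedCoalescence e.injective T (fun i => e.symm (u i)) block y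
  simp only [Equiv.apply_symm_apply] at hI
  set S := {ω | ∀ i, coalescing e (fun j t => X j t ω) (u i) T = y (block i)} with hS
  have hae : (fun ω => (coalescenceMatrix (P.prob T T) (fun i =>
      rankedCoalescence (fun j t => X (e j) t ω) (e.symm (u i)) T) block y).det) =ᵐ[μ]
      S.indicator 1 := by
    filter_upwards [hX.ae_coalescing_monotone hskip e T] with ω hω
    exact (det_coalescenceMatrix_identity (P.prob_self T) (hω.comp hu) hv hb).trans
      (by simp only [Set.indicator, hS, Set.mem_ofPred_eq, Pi.one_apply]; rfl)
  -- Measurability of the event comes from the determinant, itself a pointwise limit of measurable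
  -- grid versions.
  have hSm : NullMeasurableSet S μ := by
    have h1 : AEMeasurable (S.indicator (1 : Ω → ℝ)) μ := (hm.congr hae).aemeasurable
    exact (aemeasurable_indicator_const_iff (1 : ℝ)).1 h1
  rw [← hI, integral_congr_ae hae, integral_indicator₀ hSm]
  simp

end IsIndepMarkovFamily

/-! ### From patterns to flanking particles -/

theorem GloballyIncreasing.sigma_eq {m : ℕ} {n : Fin m → ℕ} {y : (α : Fin m) → Fin (n α) → ℤ}
    (hy : GloballyIncreasing y) {a b : Σ α : Fin m, Fin (n α)} (h : y a.1 a.2 = y b.1 b.2) :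
    a = b := by
  obtain ⟨α, i⟩ := a
  obtain ⟨β, j⟩ := b
  rcases lt_trichotomy α β with hαβ | rfl | hαβ
  · exact absurd h (hy.2 α β hαβ i j).ne
  · obtain rfl : i = j := (hy.1 α).injective h
    rfl
  · exact absurd h (hy.2 β α hαβ j i).ne'

theorem Flanking.le_iff {m : ℕ} {k : Fin m → ℕ} {a b : Flanking k} (h : a ≤ b) :
    (ofLex a).1 < (ofLex b).1 ∨
      ∃ α, ∃ i j : Fin (2 * k α), i ≤ j ∧ a = toLex ⟨α, i⟩ ∧ b = toLex ⟨α, j⟩ := by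
  obtain ⟨α, i⟩ := a
  obtain ⟨β, j⟩ := b
  rcases Sigma.Lex.le_def.1 h with h | ⟨h, h'⟩
  · exact Or.inl h
  · obtain rfl : α = β := h
    exact Or.inr ⟨α, i, j, h', rfl, rfl⟩

/-- Monotonicity is only weak: walls at distance one share a flanking site. -/
theorem flankingPosition_monotone {m : ℕ} {k : Fin m → ℕ} {x : (α : Fin m) → Fin (k α) → ℤ}
    (hx : GloballyIncreasing x) : Monotone (flankingPosition x) := by
  intro a b hab
  rcases Flanking.le_iff hab with h | ⟨α, i, j, hij, rfl, rfl⟩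
  · have h1 := hx.2 _ _ h ⟨(ofLex a).2 / 2, by have := (ofLex a).2.isLt; omega⟩
      ⟨(ofLex b).2 / 2, by have := (ofLex b).2.isLt; omega⟩
    simp only [flankingPosition]
    omega
  · have hij : i.val ≤ j.val := hij
    simp only [flankingPosition, ofLex_toLex]
    rcases (Nat.div_le_div_right (c := 2) hij).lt_or_eq with h | h
    · have h1 := hx.1 α (show (⟨i / 2, by omega⟩ : Fin (k α)) < ⟨j / 2, by omega⟩ from h)
      omega
    · simp only [h]
      omega

theorem flankingBlock_monotone {m : ℕ} {k : Fin m → ℕ} {y : (α : Fin m) → Fin (k α + 1) → ℤ}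
    (hy : GloballyIncreasing y) :
    Monotone fun q : Flanking k => y (flankingBlock q).1 (flankingBlock q).2 := by
  intro a b hab
  rcases Flanking.le_iff hab with h | ⟨α, i, j, hij, rfl, rfl⟩
  · exact (hy.2 _ _ h _ _).le
  · refine (hy.1 α).monotone ?_
    have hij : i.val ≤ j.val := hij
    exact Nat.div_le_div_right (c := 2) (Nat.succ_le_succ hij)

theorem exists_between_of_not_mem {k : ℕ} {x : Fin k → ℤ} (hx : StrictMono x) {w : ℤ}
    (hl : ∃ l, x l ≤ w) (hr : ∃ l, w ≤ x l) (hw : ¬ ∃ l, x l = w) :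
    ∃ l l' : Fin k, l'.val = l.val + 1 ∧ x l < w ∧ w < x l' := by
  obtain ⟨l, hlw, hmax⟩ := WellFounded.has_min (wellFounded_gt (α := Fin k)) {l | x l ≤ w} hl
  obtain ⟨r, hr⟩ := hr
  have hlw' : x l < w := lt_of_le_of_ne hlw fun h => hw ⟨l, h⟩
  have hlr : l < r := hx.lt_iff_lt.1 (hlw'.trans_le hr)
  have hlr' : l.val < r.val := hlr
  refine ⟨l, ⟨l + 1, by omega⟩, rfl, hlw', ?_⟩
  by_contra hle
  exact hmax ⟨l + 1, by omega⟩ (not_lt.1 hle) (show l.val < l.val + 1 by omega)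

/-- The endpoints of the flanking particles already exclude further walls: the two particles facing
each other across a gap end together, and monotonicity makes `z` constant between them. Strictness
of `y` makes every `x l` a wall. -/
theorem containsPattern_iff {z : ℤ → ℤ} (hz : Monotone z) {k : ℕ} {x : Fin k → ℤ}
    (hx : StrictMono x) {y : Fin (k + 1) → ℤ} (hy : StrictMono y) :
    ContainsPattern z x y ↔ ∀ a : Fin (2 * k),
      z (x ⟨a / 2, by omega⟩ + (a % 2 : ℕ)) = y ⟨(a + 1) / 2, by omega⟩ := by
  constructor
  · rintro ⟨-, -, h⟩ a
    obtain ⟨h1, h2⟩ := h ⟨a / 2, by omega⟩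
    rcases Nat.mod_two_eq_zero_or_one a with h0 | h0
    · rw [h0, Nat.cast_zero, add_zero, h1]
      congr 1
      ext
      simp only [Fin.val_castSucc]
      omega
    · rw [h0, Nat.cast_one, h2]
      congr 1
      ext
      simp only [Fin.val_succ]
      omega
  · intro h
    have hflank : ∀ l : Fin k, z (x l) = y l.castSucc ∧ z (x l + 1) = y l.succ := by
      intro l
      constructor
      · have h1 := h ⟨2 * l, by omega⟩
        simp only [Nat.mul_mod_right, Nat.cast_zero, add_zero] at h1
        convert h1 using 2
        · congr 1; ext; simp
        · ext; simp only [Fin.val_castSucc]; omega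
      · have h1 := h ⟨2 * l + 1, by omega⟩
        simp only [Nat.mul_add_mod, Nat.one_mod, Nat.cast_one] at h1
        convert h1 using 2
        · congr 2; ext; simp only; omega
        · ext; simp only [Fin.val_succ]; omega
    refine ⟨fun l => ?_, fun w hw hl hr => ?_, hflank⟩
    · unfold IsWall
      rw [(hflank l).1, (hflank l).2]
      exact (hy Fin.castSucc_lt_succ).ne
    · by_contra hn
      obtain ⟨l, l', hll', h1, h2⟩ := exists_between_of_not_mem hx hl hr hn
      have heq : z (x l + 1) = z (x l') := by
        rw [(hflank l).2, (hflank l').1]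
        congr 1
        ext
        simp [hll']
      refine hw (le_antisymm (hz (by omega)) ?_)
      calc z (w + 1) ≤ z (x l') := hz (by omega)
        _ = z (x l + 1) := heq.symm
        _ ≤ z w := hz (by omega)

theorem mainTheorem2 {Ω : Type*} [MeasurableSpace Ω] (μ : Measure Ω) [IsProbabilityMeasure μ]
    (P : TransitionFunction) (X : ℤ → ℝ≥0 → Ω → ℤ)
    (hX : IsIndepMarkovFamily P X μ) (hskip : SkipFree X μ)
    (e : ℕ ≃ ℤ) (T : ℝ≥0) (hT : 0 < T)
    (m : ℕ) (k : Fin m → ℕ) (hk : ∀ α, 1 ≤ k α)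
    (x : (α : Fin m) → Fin (k α) → ℤ) (y : (α : Fin m) → Fin (k α + 1) → ℤ)
    (hx : GloballyIncreasing x) (hy : GloballyIncreasing y) :
    μ.real {ω | ∀ α, ContainsPattern
        (fun i => coalescing e (fun j t => X j t ω) i T) (x α) (y α)} =
      (multiPatternMatrix (P.prob 0 T) x y).det := by
  have hae : {ω | ∀ α, ContainsPattern
      (fun i => coalescing e (fun j t => X j t ω) i T) (x α) (y α)} =ᵐ[μ]
      {ω | ∀ q : Flanking k, coalescing e (fun j t => X j t ω) (flankingPosition x q) T =
        y (flankingBlock q).1 (flankingBlock q).2} := by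
    filter_upwards [hX.ae_coalescing_monotone hskip e T] with ω hω
    refine propext ((forall_congr' fun α => containsPattern_iff hω (hx.1 α) (hy.1 α)).trans ?_)
    exact ⟨fun h q => h (ofLex q).1 (ofLex q).2, fun h α a => h (toLex ⟨α, a⟩)⟩
  rw [measureReal_congr hae]
  exact hX.measureReal_coalescing_eq hskip e T (flankingPosition_monotone hx)
    (block := flankingBlock) (y := fun b => y b.1 b.2) (flankingBlock_monotone hy)
    fun _ _ h => hy.sigma_eq h
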